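/- For each $n\ge 1$ let $m_n$ be a positive integer, let $X_n$ be a random variable with values in $\{1,\dots,m_n\}$ and $p_n(i):=\mathbb P(X_n=i)>0$ for $i=1,\dots,m_n$, and let $X_{n,1},\dots,X_{n,n}$ be independent random variables, each with the same distribution as $X_n$. (No relation between the rows for different $n$ is assumed.) Let $$\hat p_n(i)=\frac1n\sum_{k=1}^n I(X_{n,k}=i),\qquad \chi_n^2=n\sum_{i=1}^{m_n}\frac{(\hat p_n(i)-p_n(i))^2}{p_n(i)}$$ be the empirical frequencies and the Pearson chi-square statistic. Assume that, as $n\to\infty$, $$\text{(C)}\quad \frac{1}{m_n n}\,\mathrm{Var}\!\left(\frac1{p_n(X_n)}\right)\to 0\qquad\text{and}\qquad \frac{n}{\sqrt{m_n}}\to\lambda\in(0,\infty).$$ Then $$\frac{\chi_n^2-m_n}{\sqrt{2m_n}}\ \xrightarrow{d}\ \frac{\sqrt2}{\lambda}\,Z-\frac{\lambda}{\sqrt2},\qquad Z\sim\mathrm{Poisson}\!\left(\frac{\lambda^2}{2}\right).$$ -/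

import Mathlib

open MeasureTheory ProbabilityTheory Filter Topology

noncomputable section

/-- The empirical frequency of class `i` in the sample `x 0, …, x (n-1)`. -/
def empiricalFreq {n m : ℕ} (x : Fin n → Fin m) (i : Fin m) : ℝ :=
  (n : ℝ)⁻¹ * ∑ k : Fin n, if x k = i then (1 : ℝ) else 0

/-- The Pearson chi-square statistic of the sample `x` of size `n` for the class
probabilities `p` on `m` classes. -/
def pearsonChiSq {n m : ℕ} (p : Fin m → ℝ) (x : Fin n → Fin m) : ℝ :=
  (n : ℝ) * ∑ i : Fin m, (empiricalFreq x i - p i) ^ 2 / p i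

end

/-! With `N_i` the count of class `i`, the identity `N² = 2 * choose N 2 + N` writes the centred and
scaled statistic as `c * (∑ (M p_i)⁻¹ choose (N_i) 2 + ½ ∑_k ((M p (x k))⁻¹ - 1)) - c⁻¹` with `c =
√(2M) / n`, `M = m_n` (`pearsonChiSq_eq_centredPearson`). Let `V` be the second moment of `1 / (M p)
- 1` under `p`. Since `n² / M → λ²`, condition (C) says `n V → 0`. The weights can then be replaced
by 1 and the linear term dropped, so the statistic is close to `a * C - a⁻¹`, where `a = √2 / λ` and
`C` counts pairs of equal draws. Classes with `p > 2 / M` would spoil the moment bounds. Their total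
mass is at most `4 V`, so with probability at least `1 - 4 n V` none is drawn, and `C` only counts
the light classes. It remains to see that `C` is asymptotically Poisson. Adding one draw to a sample
of size `l` multiplies `E z^C`, for `|z| = 1`, by about `1 + (z - 1) l / M ≈ exp ((z - 1) l / M)`.
The product over `l < n` is `exp ((z - 1) n (n - 1) / (2M))`, which tends to the Poisson value
(`norm_iidExp_pow_collisions_sub_exp_le`). Taking `z = exp (i t a)` gives the characteristic
function of the limit. -/

noncomputable section

/-! ### Finite expectations, counts and collisions -/

/-- The expectation of `f` under `n` independent draws from the weights `p`. -/
def iidExp {ι E : Type*} [Fintype ι] [AddCommMonoid E] [Module ℝ E] (p : ι → ℝ) (n : ℕ)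
    (f : (Fin n → ι) → E) : E :=
  ∑ x : Fin n → ι, (∏ k, p (x k)) • f x

/-- The number of occurrences of `i` in the sample `x`. -/
def sampleCount {ι : Type*} [DecidableEq ι] {n : ℕ} (x : Fin n → ι) (i : ι) : ℕ :=
  ∑ k : Fin n, if x k = i then 1 else 0

/-- The number of pairs of equal entries of the sample `x` with common value in `A`. -/
def collisions {ι : Type*} [DecidableEq ι] (A : Finset ι) {n : ℕ} (x : Fin n → ι) : ℕ :=
  ∑ i ∈ A, (sampleCount x i).choose 2

end

lemma sampleCount_cons {ι : Type*} [DecidableEq ι] {n : ℕ} (j : ι) (x : Fin n → ι) (i : ι) :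
    sampleCount (Fin.cons j x : Fin (n + 1) → ι) i
      = sampleCount x i + if j = i then 1 else 0 := by
  simp only [sampleCount, Fin.sum_univ_succ, Fin.cons_zero, Fin.cons_succ, add_comm]

/-- The new draw forms one new pair with each earlier occurrence of its class. -/
lemma collisions_cons {ι : Type*} [DecidableEq ι] {n : ℕ} (A : Finset ι) (j : ι) (x : Fin n → ι) :
    collisions A (Fin.cons j x : Fin (n + 1) → ι)
      = collisions A x + if j ∈ A then sampleCount x j else 0 := by
  have key : ∀ i, (sampleCount (Fin.cons j x : Fin (n + 1) → ι) i).choose 2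
      = (sampleCount x i).choose 2 + if j = i then sampleCount x i else 0 := by
    intro i
    rw [sampleCount_cons]
    split_ifs
    · rw [Nat.choose_succ_succ' _ 1, Nat.choose_one_right]; ring
    · simp
  simp [collisions, key, Finset.sum_add_distrib]

/-! ### Calculus and low moments of expectations over independent draws -/

section iidExp

variable {ι : Type*} [Fintype ι] {p : ι → ℝ} {n : ℕ}

section module

variable {E : Type*} [AddCommMonoid E] [Module ℝ E]

lemma iidExp_add (f g : (Fin n → ι) → E) :
    iidExp p n (fun x => f x + g x) = iidExp p n f + iidExp p n g := by
  simp [iidExp, Finset.sum_add_distrib]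

lemma iidExp_sum {κ : Type*} (s : Finset κ) (f : κ → (Fin n → ι) → E) :
    iidExp p n (fun x => ∑ j ∈ s, f j x) = ∑ j ∈ s, iidExp p n (f j) := by
  simp only [iidExp, Finset.smul_sum]
  rw [Finset.sum_comm]

lemma iidExp_zero_length (f : (Fin 0 → ι) → E) : iidExp p 0 f = f Fin.elim0 := by
  rw [iidExp, Fintype.sum_unique, Fin.prod_univ_zero, one_smul]
  exact congrArg f (Subsingleton.elim _ _)

lemma iidExp_succ (f : (Fin (n + 1) → ι) → E) :
    iidExp p (n + 1) f = ∑ j, p j • iidExp p n (fun x => f (Fin.cons j x)) := by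
  unfold iidExp
  rw [← (Fin.consEquiv (fun _ => ι)).sum_comp, Fintype.sum_prod_type]
  refine Finset.sum_congr rfl fun j _ => ?_
  rw [Finset.smul_sum]
  refine Finset.sum_congr rfl fun x _ => ?_
  rw [smul_smul, Fin.prod_univ_succ]
  rfl

lemma iidExp_const (hp : ∑ i, p i = 1) (c : E) : iidExp p n (fun _ => c) = c := by
  induction n with
  | zero => simp [iidExp_zero_length]
  | succ n ih => rw [iidExp_succ]; simp [ih, ← Finset.sum_smul, hp]

end module

lemma iidExp_const_mul {R : Type*} [Ring R] [Algebra ℝ R] (c : R) (f : (Fin n → ι) → R) :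
    iidExp p n (fun x => c * f x) = c * iidExp p n f := by
  simp [iidExp, Finset.mul_sum]

lemma iidExp_mul_const {R : Type*} [Ring R] [Algebra ℝ R] (c : R) (f : (Fin n → ι) → R) :
    iidExp p n (fun x => f x * c) = iidExp p n f * c := by
  simp [iidExp, Finset.sum_mul]

lemma iidExp_sub {E : Type*} [AddCommGroup E] [Module ℝ E] (f g : (Fin n → ι) → E) :
    iidExp p n (fun x => f x - g x) = iidExp p n f - iidExp p n g := by
  simp [iidExp, smul_sub]

lemma iidExp_mono (hp : ∀ i, 0 ≤ p i) {f g : (Fin n → ι) → ℝ} (h : ∀ x, f x ≤ g x) :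
    iidExp p n f ≤ iidExp p n g :=
  Finset.sum_le_sum fun x _ =>
    mul_le_mul_of_nonneg_left (h x) (Finset.prod_nonneg fun k _ => hp (x k))

lemma norm_iidExp_le {E : Type*} [NormedAddCommGroup E] [NormedSpace ℝ E] (hp : ∀ i, 0 ≤ p i)
    (f : (Fin n → ι) → E) : ‖iidExp p n f‖ ≤ iidExp p n (fun x => ‖f x‖) := by
  refine (norm_sum_le _ _).trans (Finset.sum_le_sum fun x _ => ?_)
  rw [norm_smul, Real.norm_of_nonneg (Finset.prod_nonneg fun k _ => hp (x k)), smul_eq_mul]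

lemma iidExp_abs_le_sqrt (hp : ∀ i, 0 ≤ p i) (hp1 : ∑ i, p i = 1) (f : (Fin n → ι) → ℝ) :
    iidExp p n (fun x => |f x|) ≤ √(iidExp p n (fun x => f x ^ 2)) := by
  apply Real.le_sqrt_of_sq_le
  -- The variance of `|f|` is nonnegative.
  have h : 0 ≤ iidExp p n (fun x => (|f x| - iidExp p n (fun x => |f x|)) ^ 2) := by
    have := iidExp_mono (n := n) hp (f := fun _ => 0)
      (g := fun x => (|f x| - iidExp p n (fun x => |f x|)) ^ 2) (fun x => by positivity)
    rwa [iidExp_const hp1] at this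
  set c := iidExp p n (fun x => |f x|) with hc
  have e : (fun x => (|f x| - c) ^ 2) = fun x => (f x ^ 2 - 2 * c * |f x|) + c ^ 2 := by
    ext x; rw [← sq_abs (f x)]; ring
  rw [e, iidExp_add, iidExp_sub, iidExp_const_mul, iidExp_const hp1, ← hc] at h
  nlinarith

/-- The mean of the sum of a function over the sample. -/
lemma iidExp_linear (hp1 : ∑ i, p i = 1) (g : ι → ℝ) :
    iidExp p n (fun x => ∑ k, g (x k)) = n * ∑ i, p i * g i := by
  induction n with
  | zero => simp [iidExp_zero_length]
  | succ n ih =>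
    rw [iidExp_succ]
    simp only [Fin.sum_univ_succ, Fin.cons_zero, Fin.cons_succ, iidExp_add, ih, iidExp_const hp1,
      smul_eq_mul, mul_add, Finset.sum_add_distrib, ← Finset.sum_mul, hp1]
    push_cast; ring

/-- The variance of the sum of a centred function over the sample. -/
lemma iidExp_linear_sq (hp1 : ∑ i, p i = 1) {g : ι → ℝ} (hg : ∑ i, p i * g i = 0) :
    iidExp p n (fun x => (∑ k, g (x k)) ^ 2) = n * ∑ i, p i * g i ^ 2 := by
  induction n with
  | zero => simp [iidExp_zero_length]
  | succ n ih =>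
    rw [iidExp_succ]
    simp only [Fin.sum_univ_succ, Fin.cons_zero, Fin.cons_succ, add_sq, iidExp_add, ih,
      iidExp_const hp1, iidExp_const_mul, iidExp_linear hp1, hg, mul_zero, add_zero,
      smul_eq_mul, mul_add, Finset.sum_add_distrib, ← Finset.sum_mul, hp1]
    push_cast; ring

variable [DecidableEq ι]

lemma sum_mul_sampleCount (g : ι → ℝ) (x : Fin n → ι) :
    ∑ i, g i * sampleCount x i = ∑ k, g (x k) := by
  simp only [sampleCount, Nat.cast_sum, Nat.cast_ite, Nat.cast_one, Nat.cast_zero, Finset.mul_sum]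
  rw [Finset.sum_comm]
  simp

lemma iidExp_sampleCount (hp1 : ∑ i, p i = 1) (i : ι) :
    iidExp p n (fun x => (sampleCount x i : ℝ)) = n * p i := by
  have := iidExp_linear (n := n) hp1 (fun j => if j = i then 1 else 0)
  simpa [sampleCount] using this

lemma iidExp_choose_two_eq (hp1 : ∑ i, p i = 1) (i : ι) :
    iidExp p n (fun x => ((sampleCount x i).choose 2 : ℝ)) = n * (n - 1) / 2 * p i ^ 2 := by
  induction n with
  | zero => simp [iidExp_zero_length, sampleCount]
  | succ n ih =>
    rw [iidExp_succ]
    have key : ∀ (j : ι) (x : Fin n → ι),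
        ((sampleCount (Fin.cons j x : Fin (n + 1) → ι) i).choose 2 : ℝ)
          = (sampleCount x i).choose 2 + (if j = i then 1 else 0) * sampleCount x i := by
      intro j x
      rw [sampleCount_cons]
      split_ifs
      · rw [Nat.choose_succ_succ' _ 1, Nat.choose_one_right]; push_cast; ring
      · simp
    simp only [key, iidExp_add, ih, iidExp_const_mul, iidExp_sampleCount hp1, smul_eq_mul, mul_add,
      Finset.sum_add_distrib, ← Finset.sum_mul, hp1]
    simp
    ring

lemma iidExp_choose_two_le (hp1 : ∑ i, p i = 1) (i : ι) :
    iidExp p n (fun x => ((sampleCount x i).choose 2 : ℝ)) ≤ (n : ℝ) ^ 2 / 2 * p i ^ 2 := by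
  rw [iidExp_choose_two_eq hp1]
  gcongr
  nlinarith [Nat.cast_nonneg (α := ℝ) n]

end iidExp

/-! ### Poisson approximation of the number of collisions -/

/-- The difference is `∑_{k < N} (z ^ k - 1) (z - 1)`, whose `k`-th term is 0 for `k = 0` and at
most 4 otherwise, hence at most `4 k`. The bound is left in terms of `choose N 2` because the mean
of that quantity for a count is of order `p²`. -/
lemma norm_pow_sub_one_sub_mul_le {z : ℂ} (hz : ‖z‖ = 1) (N : ℕ) :
    ‖z ^ N - 1 - N * (z - 1)‖ ≤ 4 * N.choose 2 := by
  induction N with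
  | zero => simp
  | succ N ih =>
    have e : z ^ (N + 1) - 1 - ((N + 1 : ℕ) : ℂ) * (z - 1)
        = (z ^ N - 1 - N * (z - 1)) + (z ^ N - 1) * (z - 1) := by push_cast; ring
    have h : ‖(z ^ N - 1) * (z - 1)‖ ≤ 4 * N := by
      rcases Nat.eq_zero_or_pos N with rfl | hN
      · simp
      · have h1 : ‖z ^ N - 1‖ ≤ 2 := (norm_sub_le _ _).trans (by simp [hz]; norm_num)
        have h2 : ‖z - 1‖ ≤ 2 := (norm_sub_le _ _).trans (by simp [hz]; norm_num)
        have h3 : (1 : ℝ) ≤ N := by exact_mod_cast hN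
        rw [norm_mul]
        nlinarith [norm_nonneg (z ^ N - 1), norm_nonneg (z - 1)]
    rw [e, Nat.choose_succ_succ' _ 1, Nat.choose_one_right]
    push_cast
    linarith [norm_add_le (z ^ N - 1 - N * (z - 1)) ((z ^ N - 1) * (z - 1))]

section recursion

variable {ι : Type*} [Fintype ι] {p : ι → ℝ} {A : Finset ι} {M : ℝ}

/-- Cubes arise twice: from `p_j` times the mean of `choose (N_j) 2`, and from the variance of `∑
p_j N_j`. -/
lemma sum_cube_le (hp : ∀ i, 0 ≤ p i) (hp1 : ∑ i, p i = 1) (hA : ∀ i ∈ A, p i ≤ 2 / M) :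
    ∑ i ∈ A, p i ^ 3 ≤ 4 / M ^ 2 := by
  calc ∑ i ∈ A, p i ^ 3 ≤ ∑ i ∈ A, p i * (4 / M ^ 2) := by
        refine Finset.sum_le_sum fun i hi => ?_
        have h : p i ^ 2 ≤ (2 / M) ^ 2 := pow_le_pow_left₀ (hp i) (hA i hi) 2
        have h' : (2 / M) ^ 2 = 4 / M ^ 2 := by rw [div_pow]; norm_num
        nlinarith [hp i]
    _ = (∑ i ∈ A, p i) * (4 / M ^ 2) := by rw [Finset.sum_mul]
    _ ≤ 1 * (4 / M ^ 2) := by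
        gcongr
        rw [← hp1]
        exact Finset.sum_le_univ_sum_of_nonneg hp
    _ = _ := one_mul _

variable [DecidableEq ι]

/-- Average over the class `j` of the extra draw with the other draws fixed. A class outside `A`
creates no pair and contributes the factor 1. -/
lemma iidExp_pow_collisions_succ (z : ℂ) (l : ℕ) (hp1 : ∑ i, p i = 1) :
    iidExp p (l + 1) (fun x => z ^ collisions A x)
      = iidExp p l (fun x => z ^ collisions A x
          * (1 + ∑ j ∈ A, (p j : ℂ) * (z ^ sampleCount x j - 1))) := by
  rw [iidExp_succ]
  have hp1' : ∑ i, (p i : ℂ) = 1 := by exact_mod_cast hp1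
  have e : ∀ x : Fin l → ι, z ^ collisions A x
      * (1 + ∑ j ∈ A, (p j : ℂ) * (z ^ sampleCount x j - 1))
      = ∑ j, (p j : ℂ) * (z ^ (collisions A (Fin.cons j x : Fin (l + 1) → ι))) := by
    intro x
    have : ∑ j ∈ A, (p j : ℂ) * (z ^ sampleCount x j - 1)
        = ∑ j, (p j : ℂ) * (z ^ (if j ∈ A then sampleCount x j else 0) - 1) := by
      rw [← Finset.sum_subset (Finset.subset_univ A)]
      · exact Finset.sum_congr rfl fun j hj => by rw [if_pos hj]
      · intro j _ hj; simp [hj]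
    rw [this]
    nth_rewrite 1 [← hp1']
    rw [← Finset.sum_add_distrib, Finset.mul_sum]
    refine Finset.sum_congr rfl fun j _ => ?_
    rw [collisions_cons, pow_add]
    ring
  simp only [e, iidExp_sum, iidExp_const_mul, Complex.real_smul]

lemma norm_iidExp_pow_collisions_le (hp : ∀ i, 0 ≤ p i) (hp1 : ∑ i, p i = 1)
    {z : ℂ} (hz : ‖z‖ = 1) (l : ℕ) :
    ‖iidExp p l (fun x => z ^ collisions A x)‖ ≤ 1 := by
  refine (norm_iidExp_le hp _).trans ?_
  simp [hz, iidExp_const hp1]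

/-- `∑ p_j N_j` is a sum over the draws of the function equal to `p` on `A` and 0 elsewhere, of mean
`s`. Its variance is therefore at most `l ∑_A p³ ≤ 4 l / M²`. -/
lemma iidExp_abs_sum_mul_sampleCount_sub_le (hp : ∀ i, 0 ≤ p i) (hp1 : ∑ i, p i = 1)
    (hM : 0 < M) (hA : ∀ i ∈ A, p i ≤ 2 / M) (l : ℕ) :
    iidExp p l (fun x => |∑ j ∈ A, p j * sampleCount x j - l * ∑ j ∈ A, p j ^ 2|)
      ≤ 2 * √l / M := by
  set s := ∑ j ∈ A, p j ^ 2 with hs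
  set g : ι → ℝ := fun i => (if i ∈ A then p i else 0) - s with hg
  have e : ∀ x : Fin l → ι, ∑ j ∈ A, p j * sampleCount x j - l * s = ∑ k, g (x k) := by
    intro x
    rw [hg, Finset.sum_sub_distrib, ← sum_mul_sampleCount (fun i => if i ∈ A then p i else 0) x]
    simp [Finset.sum_ite_mem]
  have hg0 : ∑ i, p i * g i = 0 := by
    simp only [hg, mul_sub, Finset.sum_sub_distrib, ← Finset.sum_mul, hp1, mul_ite, mul_zero,
      Finset.sum_ite_mem, Finset.univ_inter]
    simp [hs, sq]
  have hg2 : ∑ i, p i * g i ^ 2 ≤ 4 / M ^ 2 := by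
    refine le_trans ?_ (sum_cube_le hp hp1 hA)
    have : ∑ i, p i * g i ^ 2 = ∑ i, p i * (if i ∈ A then p i else 0) ^ 2 - s ^ 2 := by
      have h1 : ∀ i, p i * g i ^ 2
          = p i * (if i ∈ A then p i else 0) ^ 2 - 2 * s * (p i * g i) - s ^ 2 * p i := by
        intro i; simp only [hg]; ring
      simp only [h1, Finset.sum_sub_distrib, ← Finset.mul_sum, hg0, hp1]
      ring
    rw [this]
    have h2 : ∑ i, p i * (if i ∈ A then p i else 0) ^ 2 = ∑ i ∈ A, p i ^ 3 := by
      rw [← Finset.sum_subset (Finset.subset_univ A)]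
      · exact Finset.sum_congr rfl fun j hj => by rw [if_pos hj]; ring
      · intro j _ hj; simp [hj]
    rw [h2]
    linarith [sq_nonneg s]
  simp only [e]
  refine (iidExp_abs_le_sqrt hp hp1 _).trans ?_
  rw [iidExp_linear_sq hp1 hg0]
  apply Real.sqrt_le_iff.2 ⟨by positivity, ?_⟩
  rw [div_pow, mul_pow, Real.sq_sqrt (Nat.cast_nonneg l)]
  calc (l : ℝ) * ∑ i, p i * g i ^ 2 ≤ l * (4 / M ^ 2) := by gcongr
    _ = _ := by ring

/-- Drawing one more observation multiplies the generating function of the number of collisions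
by approximately `exp ((z - 1) * l / M)`. -/
lemma norm_iidExp_pow_collisions_succ_sub_le (hp : ∀ i, 0 ≤ p i) (hp1 : ∑ i, p i = 1)
    (hM : 0 < M) (hA : ∀ i ∈ A, p i ≤ 2 / M) {z : ℂ} (hz : ‖z‖ = 1) {l : ℕ}
    (hl : 2 * (l : ℝ) ≤ M) :
    ‖iidExp p (l + 1) (fun x => z ^ collisions A x)
        - iidExp p l (fun x => z ^ collisions A x) * Complex.exp ((z - 1) * (l / M : ℝ))‖
      ≤ 12 * l ^ 2 / M ^ 2 + 4 * √l / M + 2 * l * |∑ i ∈ A, p i ^ 2 - 1 / M| := by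
  have hz1 : ‖z - 1‖ ≤ 2 := (norm_sub_le _ _).trans (by simp [hz]; norm_num)
  set s := ∑ i ∈ A, p i ^ 2 with hs
  set G := iidExp p l (fun x => z ^ collisions A x) with hG
  set u : ℂ := (z - 1) * (l / M : ℝ) with hu
  have hlM : 0 ≤ (l : ℝ) / M := by positivity
  have hu2 : ‖u‖ ≤ 2 * (l / M) := by
    rw [hu, norm_mul, Complex.norm_real, Real.norm_of_nonneg hlM]
    gcongr
  -- This is where `2 l ≤ M` is needed: the quadratic bound for `exp u - 1 - u` requires `‖u‖ ≤ 1`.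
  have hu1 : ‖u‖ ≤ 1 := hu2.trans (by rw [← mul_div_assoc, div_le_one hM]; exact hl)
  have hexp : ‖Complex.exp u - 1 - u‖ ≤ 4 * l ^ 2 / M ^ 2 :=
    (Complex.norm_exp_sub_one_sub_id_le hu1).trans <| by
      calc ‖u‖ ^ 2 ≤ (2 * (l / M)) ^ 2 := by gcongr
        _ = _ := by ring
  -- Three sources of error: linearising `z ^ N - 1`, the fluctuation of `∑ p_j N_j` about its mean
  -- `l s`, and replacing `s` by `1 / M`.
  set F : (Fin l → ι) → ℂ := fun x => z ^ collisions A x *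
    (∑ j ∈ A, (p j : ℂ) * (z ^ sampleCount x j - 1 - sampleCount x j * (z - 1))
      + (z - 1) * ((∑ j ∈ A, p j * sampleCount x j - l * s : ℝ) : ℂ)
      + (z - 1) * ((l * (s - 1 / M) : ℝ) : ℂ)) with hF
  have e : iidExp p (l + 1) (fun x => z ^ collisions A x) - G * Complex.exp u
      = iidExp p l F - G * (Complex.exp u - 1 - u) := by
    have h : ∀ x : Fin l → ι, z ^ collisions A x
          * (1 + ∑ j ∈ A, (p j : ℂ) * (z ^ sampleCount x j - 1))
        = F x + z ^ collisions A x * (1 + u) := by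
      intro x
      have h1 : ∑ j ∈ A, (p j : ℂ) * (z ^ sampleCount x j - 1)
          = ∑ j ∈ A, (p j : ℂ) * (z ^ sampleCount x j - 1 - sampleCount x j * (z - 1))
            + (z - 1) * ∑ j ∈ A, (p j : ℂ) * sampleCount x j := by
        rw [Finset.mul_sum, ← Finset.sum_add_distrib]
        exact Finset.sum_congr rfl fun j _ => by ring
      rw [h1, hF, hu]
      push_cast
      ring
    rw [iidExp_pow_collisions_succ z l hp1]
    simp only [h]
    rw [iidExp_add, iidExp_mul_const, ← hG]
    ring
  have hFx : ∀ x, ‖F x‖ ≤ ∑ j ∈ A, p j * (4 * (sampleCount x j).choose 2)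
      + 2 * |∑ j ∈ A, p j * sampleCount x j - l * s| + 2 * (l * |s - 1 / M|) := by
    intro x
    rw [hF]
    simp only [norm_mul, norm_pow, hz, one_pow, one_mul]
    refine (norm_add₃_le).trans ?_
    gcongr ?_ + ?_ + ?_
    · refine (norm_sum_le _ _).trans (Finset.sum_le_sum fun j _ => ?_)
      rw [norm_mul, Complex.norm_real, Real.norm_of_nonneg (hp j)]
      exact mul_le_mul_of_nonneg_left (norm_pow_sub_one_sub_mul_le hz _) (hp j)
    · rw [norm_mul, Complex.norm_real, Real.norm_eq_abs]
      gcongr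
    · rw [norm_mul, Complex.norm_real, Real.norm_eq_abs, abs_mul, Nat.abs_cast]
      gcongr
  -- The 8 comes from linearising; the remaining 4 of the constant 12 comes from `exp u - 1 - u`.
  have hEF : ‖iidExp p l F‖ ≤ 8 * l ^ 2 / M ^ 2 + 4 * √l / M + 2 * (l * |s - 1 / M|) := by
    refine (norm_iidExp_le hp _).trans ((iidExp_mono hp hFx).trans ?_)
    rw [iidExp_add, iidExp_add, iidExp_const hp1, iidExp_sum, iidExp_const_mul]
    simp only [iidExp_const_mul]
    gcongr ?_ + ?_ + _
    · calc ∑ j ∈ A, p j * (4 * iidExp p l (fun x => ((sampleCount x j).choose 2 : ℝ)))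
          ≤ ∑ j ∈ A, p j * (4 * ((l : ℝ) ^ 2 / 2 * p j ^ 2)) := by
            refine Finset.sum_le_sum fun j _ => ?_
            have := hp j
            gcongr
            exact iidExp_choose_two_le hp1 j
        _ = 2 * (l : ℝ) ^ 2 * ∑ j ∈ A, p j ^ 3 := by
            rw [Finset.mul_sum]; exact Finset.sum_congr rfl fun j _ => by ring
        _ ≤ 2 * (l : ℝ) ^ 2 * (4 / M ^ 2) := by
            gcongr; exact sum_cube_le hp hp1 hA
        _ = _ := by ring
    · calc _ ≤ 2 * (2 * √l / M) := by
            gcongr; exact iidExp_abs_sum_mul_sampleCount_sub_le hp hp1 hM hA l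
        _ = _ := by ring
  rw [e]
  have hGle : ‖G‖ ≤ 1 := norm_iidExp_pow_collisions_le hp hp1 hz l
  have h2 : ‖G * (Complex.exp u - 1 - u)‖ ≤ 4 * l ^ 2 / M ^ 2 := by
    rw [norm_mul]
    exact (mul_le_of_le_one_left (norm_nonneg _) hGle).trans hexp
  refine (norm_sub_le _ _).trans ((add_le_add hEF h2).trans (le_of_eq ?_))
  ring

/-- The generating function of the number of collisions on the unit circle is close to that of
a Poisson variable with mean `n * (n - 1) / (2 * M)`. -/
lemma norm_iidExp_pow_collisions_sub_exp_le (hp : ∀ i, 0 ≤ p i) (hp1 : ∑ i, p i = 1)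
    (hM : 0 < M) (hA : ∀ i ∈ A, p i ≤ 2 / M) {z : ℂ} (hz : ‖z‖ = 1) {n : ℕ}
    (hn : 2 * (n : ℝ) ≤ M) :
    ‖iidExp p n (fun x => z ^ collisions A x)
        - Complex.exp ((z - 1) * (n * (n - 1) / (2 * M) : ℝ))‖
      ≤ n * (12 * n ^ 2 / M ^ 2 + 4 * √n / M + 2 * n * |∑ i ∈ A, p i ^ 2 - 1 / M|) := by
  set B := 12 * (n : ℝ) ^ 2 / M ^ 2 + 4 * √n / M + 2 * n * |∑ i ∈ A, p i ^ 2 - 1 / M|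
  -- `B` is the one-step error at `l = n`; it dominates the error at every earlier step.
  suffices h : ∀ l ≤ n, ‖iidExp p l (fun x => z ^ collisions A x)
        - Complex.exp ((z - 1) * (l * (l - 1) / (2 * M) : ℝ))‖ ≤ l * B from h n le_rfl
  intro l
  induction l with
  | zero => intro _; simp [iidExp_zero_length, collisions, sampleCount]
  | succ l ih =>
    intro hl
    have hln : (l : ℝ) ≤ n := by exact_mod_cast (Nat.le_of_succ_le hl)
    have h1 := norm_iidExp_pow_collisions_succ_sub_le hp hp1 hM hA hz
      (l := l) (by linarith)
    have hB : 12 * (l : ℝ) ^ 2 / M ^ 2 + 4 * √l / M + 2 * l * |∑ i ∈ A, p i ^ 2 - 1 / M| ≤ B := by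
      simp only [B]; gcongr
    set u : ℂ := (z - 1) * (l / M : ℝ) with hu
    -- Since `Re (z - 1) ≤ 0`, the multiplier has norm at most 1, so one-step errors add up without
    -- being amplified.
    have hue : ‖Complex.exp u‖ ≤ 1 := by
      rw [Complex.norm_exp, Real.exp_le_one_iff, hu, Complex.re_mul_ofReal]
      have : z.re ≤ 1 := hz ▸ Complex.re_le_norm z
      exact mul_nonpos_of_nonpos_of_nonneg (by simpa using this) (by positivity)
    have e : Complex.exp ((z - 1) * (((l + 1 : ℕ) : ℝ) * (((l + 1 : ℕ) : ℝ) - 1) / (2 * M) : ℝ))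
        = Complex.exp ((z - 1) * (l * (l - 1) / (2 * M) : ℝ)) * Complex.exp u := by
      rw [← Complex.exp_add, hu, ← mul_add, ← Complex.ofReal_add]
      congr 3
      push_cast
      field_simp
      ring
    rw [e]
    have h2 := ih (Nat.le_of_succ_le hl)
    set G := iidExp p l (fun x => z ^ collisions A x)
    set D := Complex.exp ((z - 1) * (l * (l - 1) / (2 * M) : ℝ))
    have h3 : ‖(G - D) * Complex.exp u‖ ≤ l * B := by
      rw [norm_mul]
      exact (mul_le_of_le_one_right (norm_nonneg _) hue).trans h2
    calc _ = ‖(iidExp p (l + 1) (fun x => z ^ collisions A x) - G * Complex.exp u)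
            + (G - D) * Complex.exp u‖ := by congr 1; ring
      _ ≤ B + l * B := (norm_add_le _ _).trans (add_le_add (h1.trans hB) h3)
      _ = _ := by push_cast; ring

end recursion

/-! ### Light and heavy classes -/

section truncation

variable {ι : Type*} [Fintype ι] {p : ι → ℝ} {M : ℝ}

noncomputable section

/-- The classes whose probability is at most `2 / M`. -/
def lightClasses (p : ι → ℝ) (M : ℝ) : Finset ι := {i | p i ≤ 2 / M}

/-- The second moment of `1 / (M * p) - 1` under `p`. -/
def invProbVar (p : ι → ℝ) (M : ℝ) : ℝ := ∑ i, p i * ((M * p i)⁻¹ - 1) ^ 2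

end

lemma invProbVar_nonneg (hp : ∀ i, 0 ≤ p i) : 0 ≤ invProbVar p M :=
  Finset.sum_nonneg fun i _ => mul_nonneg (hp i) (sq_nonneg _)

lemma sum_mul_abs_inv_sub_one_le (hp : ∀ i, 0 ≤ p i) (hp1 : ∑ i, p i = 1) :
    ∑ i, p i * |(M * p i)⁻¹ - 1| ≤ √(invProbVar p M) := by
  -- Cauchy–Schwarz for a single draw.
  have := iidExp_abs_le_sqrt (n := 1) hp hp1 (fun x => (M * p (x 0))⁻¹ - 1)
  simpa [iidExp_succ, iidExp_zero_length, invProbVar] using this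

/-- One factor `p i` is traded for `2 / M`, turning the second-moment weights of pair counts into an
expectation under `p`. -/
lemma sum_light_sq_mul_le (hp : ∀ i, 0 ≤ p i) (hM : 0 < M) {f : ι → ℝ} (hf : ∀ i, 0 ≤ f i) :
    ∑ i ∈ lightClasses p M, f i * p i ^ 2 ≤ 2 / M * ∑ i, p i * f i := by
  calc _ ≤ ∑ i ∈ lightClasses p M, 2 / M * (p i * f i) := by
        refine Finset.sum_le_sum fun i hi => ?_
        have h : p i ≤ 2 / M := by simpa [lightClasses] using hi
        have := mul_nonneg (hp i) (hf i)
        calc f i * p i ^ 2 = p i * (p i * f i) := by ring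
          _ ≤ _ := by gcongr
    _ ≤ ∑ i, 2 / M * (p i * f i) :=
        Finset.sum_le_univ_sum_of_nonneg fun i =>
          mul_nonneg (by positivity) (mul_nonneg (hp i) (hf i))
    _ = _ := by rw [Finset.mul_sum]

variable [DecidableEq ι]

/-- Chebyshev: on a heavy class `(M p)⁻¹ < 1/2`, so `((M p)⁻¹ - 1)² ≥ 1/4`. -/
lemma sum_heavy_le (hp : ∀ i, 0 < p i) (hM : 0 < M) :
    ∑ i ∈ (lightClasses p M)ᶜ, p i ≤ 4 * invProbVar p M := by
  calc ∑ i ∈ (lightClasses p M)ᶜ, p i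
      ≤ ∑ i ∈ (lightClasses p M)ᶜ, 4 * (p i * ((M * p i)⁻¹ - 1) ^ 2) := by
        refine Finset.sum_le_sum fun i hi => ?_
        have h : 2 / M < p i := by simpa [lightClasses] using hi
        have h2 : 2 < M * p i := by rw [div_lt_iff₀ hM] at h; linarith
        have h3 : (M * p i)⁻¹ ≤ 2⁻¹ := inv_anti₀ (by norm_num) h2.le
        have h4 : 1 ≤ 4 * ((M * p i)⁻¹ - 1) ^ 2 := by nlinarith
        nlinarith [hp i]
    _ ≤ ∑ i, 4 * (p i * ((M * p i)⁻¹ - 1) ^ 2) :=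
        Finset.sum_le_univ_sum_of_nonneg fun i =>
          mul_nonneg (by norm_num) (mul_nonneg (hp i).le (sq_nonneg _))
    _ = _ := by rw [invProbVar, Finset.mul_sum]

/-- Multiplied by `M`, the difference is `∑_light p (M p - 1)` minus the heavy mass. On light
classes `|M p - 1| = M p |(M p)⁻¹ - 1| ≤ 2 |(M p)⁻¹ - 1|`. -/
lemma abs_sum_light_sq_sub_le (hp : ∀ i, 0 < p i) (hp1 : ∑ i, p i = 1) (hM : 0 < M) :
    |∑ i ∈ lightClasses p M, p i ^ 2 - 1 / M|
      ≤ (2 * √(invProbVar p M) + 4 * invProbVar p M) / M := by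
  rw [le_div_iff₀ hM]
  have hp0 : ∀ i, 0 ≤ p i := fun i => (hp i).le
  have e : (∑ i ∈ lightClasses p M, p i ^ 2 - 1 / M) * M
      = ∑ i ∈ lightClasses p M, p i * (M * p i - 1) - ∑ i ∈ (lightClasses p M)ᶜ, p i := by
    have h1 : (∑ i ∈ lightClasses p M, p i) + ∑ i ∈ (lightClasses p M)ᶜ, p i = 1 := by
      rw [Finset.sum_add_sum_compl, hp1]
    have h2 : ∑ i ∈ lightClasses p M, p i * (M * p i - 1)
        = M * (∑ i ∈ lightClasses p M, p i ^ 2) - ∑ i ∈ lightClasses p M, p i := by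
      rw [Finset.mul_sum, ← Finset.sum_sub_distrib]
      exact Finset.sum_congr rfl fun i _ => by ring
    rw [h2, sub_mul, one_div_mul_cancel hM.ne']
    linarith
  have h3 : |∑ i ∈ lightClasses p M, p i * (M * p i - 1)| ≤ 2 * √(invProbVar p M) := by
    calc _ ≤ ∑ i ∈ lightClasses p M, 2 * (p i * |(M * p i)⁻¹ - 1|) := by
          refine (Finset.abs_sum_le_sum_abs _ _).trans (Finset.sum_le_sum fun i hi => ?_)
          have h : p i ≤ 2 / M := by simpa [lightClasses] using hi
          have h2 : M * p i ≤ 2 := by rw [le_div_iff₀ hM] at h; linarith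
          have h0 : 0 < M * p i := mul_pos hM (hp i)
          have : M * p i - 1 = -(M * p i * ((M * p i)⁻¹ - 1)) := by
            rw [mul_sub, mul_inv_cancel₀ h0.ne']; ring
          rw [this, abs_mul, abs_neg, abs_mul, abs_of_pos (hp i), abs_of_pos h0]
          calc p i * (M * p i * |(M * p i)⁻¹ - 1|) ≤ p i * (2 * |(M * p i)⁻¹ - 1|) := by
                have := hp0 i
                gcongr
            _ = _ := by ring
      _ ≤ ∑ i, 2 * (p i * |(M * p i)⁻¹ - 1|) :=
          Finset.sum_le_univ_sum_of_nonneg fun i =>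
            mul_nonneg (by norm_num) (mul_nonneg (hp0 i) (abs_nonneg _))
      _ ≤ _ := by
          rw [← Finset.mul_sum]
          gcongr
          exact sum_mul_abs_inv_sub_one_le hp0 hp1
  have h4 := sum_heavy_le hp hM
  have h5 : 0 ≤ ∑ i ∈ (lightClasses p M)ᶜ, p i := Finset.sum_nonneg fun i _ => hp0 i
  calc |∑ i ∈ lightClasses p M, p i ^ 2 - 1 / M| * M
      = |(∑ i ∈ lightClasses p M, p i ^ 2 - 1 / M) * M| := by rw [abs_mul, abs_of_pos hM]
    _ ≤ _ := by
      rw [e]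
      refine (abs_sub _ _).trans ?_
      rw [abs_of_nonneg h5]
      linarith

end truncation

/-! ### Replacing the statistic by a multiple of the collision count -/

section comparison

variable {ι : Type*} [Fintype ι] [DecidableEq ι] {p : ι → ℝ} {M : ℝ} {n : ℕ}

lemma norm_exp_mul_I_sub_le (u v : ℝ) :
    ‖Complex.exp (u * Complex.I) - Complex.exp (v * Complex.I)‖ ≤ |u - v| := by
  have e : Complex.exp (u * Complex.I) - Complex.exp (v * Complex.I)
      = Complex.exp (v * Complex.I) * (Complex.exp (Complex.I * ((u - v : ℝ) : ℂ)) - 1) := by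
    rw [mul_sub, ← Complex.exp_add, mul_one]
    congr 2
    push_cast
    ring
  rw [e, norm_mul, Complex.norm_exp_ofReal_mul_I, one_mul]
  exact Real.norm_exp_I_mul_ofReal_sub_one_le

lemma norm_exp_mul_I_sub_le_two (u v : ℝ) :
    ‖Complex.exp (u * Complex.I) - Complex.exp (v * Complex.I)‖ ≤ 2 := by
  refine (norm_sub_le _ _).trans ?_
  rw [Complex.norm_exp_ofReal_mul_I, Complex.norm_exp_ofReal_mul_I]
  norm_num

noncomputable section

/-- The Pearson statistic, centred by `M` and scaled, in terms of counts; here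
`c = √(2 * M) / n`. -/
def centredPearson (p : ι → ℝ) (M c : ℝ) (x : Fin n → ι) : ℝ :=
  c * (∑ i, (M * p i)⁻¹ * (sampleCount x i).choose 2 + (∑ k, ((M * p (x k))⁻¹ - 1)) / 2) - c⁻¹

end

/-- If no draw falls outside `A`, the exponents are compared term by term. Otherwise the trivial
bound 2 is absorbed by twice the number of draws outside `A`, which is at least 1. -/
lemma norm_exp_centredPearson_sub_le {c : ℝ} (hc : 0 ≤ c) (a t : ℝ) (A : Finset ι)
    (x : Fin n → ι) :
    ‖Complex.exp ((t * centredPearson p M c x : ℝ) * Complex.I)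
        - Complex.exp ((t * (a * collisions A x - a⁻¹) : ℝ) * Complex.I)‖
      ≤ |t| * (c * ∑ i ∈ A, |(M * p i)⁻¹ - 1| * (sampleCount x i).choose 2
          + c / 2 * |∑ k, ((M * p (x k))⁻¹ - 1)|
          + |c - a| * ∑ i ∈ A, ((sampleCount x i).choose 2 : ℝ) + |c⁻¹ - a⁻¹|)
        + 2 * ∑ i ∈ Aᶜ, (sampleCount x i : ℝ) := by
  set K := |t| * (c * ∑ i ∈ A, |(M * p i)⁻¹ - 1| * (sampleCount x i).choose 2
          + c / 2 * |∑ k, ((M * p (x k))⁻¹ - 1)|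
          + |c - a| * ∑ i ∈ A, ((sampleCount x i).choose 2 : ℝ) + |c⁻¹ - a⁻¹|) with hK
  have hK0 : 0 ≤ K := by positivity
  by_cases hx : ∀ i ∈ Aᶜ, sampleCount x i = 0
  · have h0 : ∑ i ∈ Aᶜ, (sampleCount x i : ℝ) = 0 :=
      Finset.sum_eq_zero fun i hi => by simp [hx i hi]
    rw [h0, mul_zero, add_zero]
    refine (norm_exp_mul_I_sub_le _ _).trans ?_
    rw [← mul_sub, abs_mul, hK]
    gcongr
    have h1 : ∑ i, (M * p i)⁻¹ * ((sampleCount x i).choose 2 : ℝ)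
        = ∑ i ∈ A, ((M * p i)⁻¹ - 1) * (sampleCount x i).choose 2
          + ∑ i ∈ A, ((sampleCount x i).choose 2 : ℝ) := by
      rw [← Finset.sum_add_distrib, ← Finset.sum_subset (Finset.subset_univ A)]
      · exact Finset.sum_congr rfl fun i _ => by ring
      · intro i _ hi; simp [hx i (by simpa using hi)]
    have h2 : centredPearson p M c x - (a * collisions A x - a⁻¹)
        = c * ∑ i ∈ A, ((M * p i)⁻¹ - 1) * (sampleCount x i).choose 2
          + c / 2 * ∑ k, ((M * p (x k))⁻¹ - 1)
          + (c - a) * ∑ i ∈ A, ((sampleCount x i).choose 2 : ℝ) + -(c⁻¹ - a⁻¹) := by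
      rw [centredPearson, h1, collisions]
      push_cast
      ring
    rw [h2]
    refine (abs_add_le _ _).trans ?_
    rw [abs_neg]
    gcongr
    refine (abs_add_three _ _ _).trans ?_
    rw [abs_mul, abs_mul, abs_mul, abs_of_nonneg hc, abs_of_nonneg (by positivity : 0 ≤ c / 2)]
    gcongr
    · refine (Finset.abs_sum_le_sum_abs _ _).trans (Finset.sum_le_sum fun i _ => ?_)
      rw [abs_mul, Nat.abs_cast]
    · rw [abs_of_nonneg (by positivity)]
  · push Not at hx
    obtain ⟨i, hi, hxi⟩ := hx
    have h1 : (1 : ℝ) ≤ ∑ i ∈ Aᶜ, (sampleCount x i : ℝ) := by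
      have h2 : (1 : ℝ) ≤ sampleCount x i := by exact_mod_cast Nat.one_le_iff_ne_zero.2 hxi
      exact h2.trans (Finset.single_le_sum (f := fun i => (sampleCount x i : ℝ))
        (fun j _ => Nat.cast_nonneg _) hi)
    refine (norm_exp_mul_I_sub_le_two _ _).trans ?_
    linarith

/-- Expectation of the pointwise bound with `A` the light classes. The linear term is centred, so it
costs only `√(n V)`; the heavy draws cost `2 * n * 4 V`. -/
lemma norm_iidExp_exp_centredPearson_sub_le (hp : ∀ i, 0 < p i) (hp1 : ∑ i, p i = 1)
    (hM : 0 < M) (hmean : ∑ i, p i * ((M * p i)⁻¹ - 1) = 0) {c : ℝ} (hc : 0 ≤ c) (a t : ℝ) :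
    ‖iidExp p n (fun x => Complex.exp ((t * centredPearson p M c x : ℝ) * Complex.I))
        - iidExp p n (fun x => Complex.exp
            ((t * (a * collisions (lightClasses p M) x - a⁻¹) : ℝ) * Complex.I))‖
      ≤ |t| * (c * (n ^ 2 / M) * √(invProbVar p M) + c / 2 * √(n * invProbVar p M)
          + |c - a| * (n ^ 2 / M) + |c⁻¹ - a⁻¹|) + 8 * (n * invProbVar p M) := by
  have hp0 : ∀ i, 0 ≤ p i := fun i => (hp i).le
  rw [← iidExp_sub]
  refine (norm_iidExp_le hp0 _).trans ((iidExp_mono hp0 fun x =>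
    norm_exp_centredPearson_sub_le hc a t (lightClasses p M) x).trans ?_)
  simp only [iidExp_add, iidExp_const_mul, iidExp_sum, iidExp_const hp1, iidExp_sampleCount hp1]
  have hf : ∀ f : ι → ℝ, (∀ i, 0 ≤ f i) → ∑ i ∈ lightClasses p M,
      f i * iidExp p n (fun x => ((sampleCount x i).choose 2 : ℝ))
        ≤ n ^ 2 / M * ∑ i, p i * f i := by
    intro f hf
    calc _ ≤ ∑ i ∈ lightClasses p M, f i * ((n : ℝ) ^ 2 / 2 * p i ^ 2) := by
          refine Finset.sum_le_sum fun i _ => ?_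
          exact mul_le_mul_of_nonneg_left (iidExp_choose_two_le hp1 i) (hf i)
      _ = (n : ℝ) ^ 2 / 2 * ∑ i ∈ lightClasses p M, f i * p i ^ 2 := by
          rw [Finset.mul_sum]; exact Finset.sum_congr rfl fun i _ => by ring
      _ ≤ (n : ℝ) ^ 2 / 2 * (2 / M * ∑ i, p i * f i) := by
          gcongr; exact sum_light_sq_mul_le hp0 hM hf
      _ = _ := by ring
  have h1 := hf (fun i => |(M * p i)⁻¹ - 1|) fun i => abs_nonneg _
  have h2 := hf (fun _ => 1) fun i => zero_le_one
  simp only [one_mul, mul_one, hp1] at h2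
  have h3 : iidExp p n (fun x => |∑ k, ((M * p (x k))⁻¹ - 1)|) ≤ √(n * invProbVar p M) := by
    refine (iidExp_abs_le_sqrt hp0 hp1 _).trans (le_of_eq ?_)
    rw [iidExp_linear_sq hp1 (g := fun i => (M * p i)⁻¹ - 1) hmean, invProbVar]
  have h4 := sum_heavy_le hp hM
  gcongr ?_ + ?_
  · gcongr ?_ * (?_ + ?_ + ?_ + _)
    · rw [mul_assoc]
      gcongr
      refine h1.trans ?_
      gcongr
      exact sum_mul_abs_inv_sub_one_le hp0 hp1
    · gcongr
    · gcongr
  · rw [← Finset.mul_sum]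
    nlinarith [mul_le_mul_of_nonneg_left h4 (Nat.cast_nonneg (α := ℝ) n)]

end comparison

/-! ### The Pearson statistic in terms of pair counts -/

section pearson

lemma pearsonChiSq_eq_centredPearson {n m : ℕ} (hn : 0 < n) {p : Fin m → ℝ}
    (hp : ∀ i, 0 < p i) (hp1 : ∑ i, p i = 1) (hm : 0 < m) (x : Fin n → Fin m) :
    (pearsonChiSq p x - m) / √(2 * m) = centredPearson p m (√(2 * m) / n) x := by
  have hn' : (n : ℝ) ≠ 0 := by positivity
  have hm' : (m : ℝ) ≠ 0 := by positivity
  have hcount : ∑ i, (sampleCount x i : ℝ) = n := by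
    simpa using sum_mul_sampleCount (fun _ => (1 : ℝ)) x
  have hfreq : ∀ i, empiricalFreq x i = (n : ℝ)⁻¹ * sampleCount x i := by
    intro i; simp [empiricalFreq, sampleCount]
  have h1 : pearsonChiSq p x
      = 2 * m / n * ∑ i, ((m : ℝ) * p i)⁻¹ * (sampleCount x i).choose 2
        + m / n * ∑ k, (((m : ℝ) * p (x k))⁻¹ - 1) + m - n := by
    -- Expand the square as `N² / (n p) - 2 N + n p` and use `N² = 2 * choose N 2 + N`; summing the
    -- last two terms gives `m - n`.
    have e : ∀ i, (n : ℝ) * ((empiricalFreq x i - p i) ^ 2 / p i)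
        = 2 * m / n * (((m : ℝ) * p i)⁻¹ * (sampleCount x i).choose 2)
          + m / n * ((((m : ℝ) * p i)⁻¹ - 1) * sampleCount x i)
          + (m / n - 2) * sampleCount x i + n * p i := by
      intro i
      have := (hp i).ne'
      rw [hfreq, Nat.cast_choose_two]
      field_simp
      ring
    rw [pearsonChiSq, Finset.mul_sum]
    simp only [e, Finset.sum_add_distrib, ← Finset.mul_sum, hcount, hp1]
    rw [sum_mul_sampleCount (fun i => ((m : ℝ) * p i)⁻¹ - 1) x]
    field_simp
    ring
  have hs : √(2 * (m : ℝ)) ≠ 0 := by positivity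
  have hs2 : √(2 * (m : ℝ)) ^ 2 = 2 * m := Real.sq_sqrt (by positivity)
  rw [h1, centredPearson]
  generalize ∑ i, ((m : ℝ) * p i)⁻¹ * ((sampleCount x i).choose 2 : ℝ) = S
  generalize ∑ k, (((m : ℝ) * p (x k))⁻¹ - 1) = R
  -- Expressing `m` through its square root `s` makes the goal a rational identity in `s`, `n`, `S`,
  -- `R`.
  have hm2 : (m : ℝ) = √(2 * (m : ℝ)) ^ 2 / 2 := by rw [hs2]; ring
  generalize √(2 * (m : ℝ)) = s at *
  rw [hm2]
  field_simp
  ring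

end pearson

/-! ### From random variables to finite sums -/

section sampling

variable {Ω ι E : Type*} [MeasurableSpace Ω] {P : Measure Ω} [IsProbabilityMeasure P]
  [Fintype ι] [MeasurableSpace ι] [MeasurableSingletonClass ι]
  [NormedAddCommGroup E] [NormedSpace ℝ E] [CompleteSpace E]
  {p : ι → ℝ} {X₀ : Ω → ι}

lemma integral_comp_eq_sum (hX₀ : Measurable X₀) (hp : ∀ i, P.real {ω | X₀ ω = i} = p i)
    (f : ι → E) : ∫ ω, f (X₀ ω) ∂P = ∑ i, p i • f i := by
  have := Measure.isProbabilityMeasure_map (μ := P) hX₀.aemeasurable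
  rw [← integral_map hX₀.aemeasurable (f := f) .of_discrete, integral_fintype .of_finite]
  refine Finset.sum_congr rfl fun i _ => ?_
  rw [map_measureReal_apply hX₀ (measurableSet_singleton i), ← hp i]
  rfl

lemma integral_sample_eq_iidExp {n : ℕ} {X : Fin n → Ω → ι} (hX₀ : Measurable X₀)
    (hX : ∀ k, Measurable (X k)) (hp : ∀ i, P.real {ω | X₀ ω = i} = p i)
    (hindep : iIndepFun X P) (hident : ∀ k, IdentDistrib (X k) (X₀) P P)
    (f : (Fin n → ι) → E) :
    ∫ ω, f (fun k => X k ω) ∂P = iidExp p n f := by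
  have hm : Measurable (fun ω k => X k ω) := measurable_pi_lambda _ hX
  have := Measure.isProbabilityMeasure_map (μ := P) hX₀.aemeasurable
  rw [← integral_map hm.aemeasurable (f := f) .of_discrete,
    hindep.map_fun_eq_pi_map fun k => (hX k).aemeasurable, integral_fintype .of_finite]
  refine Finset.sum_congr rfl fun x _ => ?_
  congr 1
  simp only [(hident _).map_eq, measureReal_def, Measure.pi_singleton, ENNReal.toReal_prod]
  refine Finset.prod_congr rfl fun k _ => ?_
  rw [← hp, Measure.map_apply hX₀ (measurableSet_singleton _)]
  rfl

end sampling

/-! ### Characteristic functions and passage to the limit -/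

lemma charFun_map_affine_poisson {Ω : Type*} [MeasurableSpace Ω] {P : Measure Ω} {Z : Ω → ℕ}
    {r : NNReal} (hZ : HasLaw Z (poissonMeasure r) P) (a b t : ℝ) :
    charFun (P.map (fun ω => a * (Z ω : ℝ) - b)) t
      = Complex.exp ((-(t * b) : ℝ) * Complex.I)
        * Complex.exp ((Complex.exp ((t * a : ℝ) * Complex.I) - 1) * (r : ℝ)) := by
  have hZm := hZ.aemeasurable
  have h := charFun_map_cast_poissonMeasure r (t * a)
  rw [charFun_apply_real, integral_map .of_discrete (by fun_prop)] at h
  rw [charFun_apply_real, integral_map (by fun_prop) (by fun_prop), mul_comm _ ((r : ℝ) : ℂ), ← h,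
    ← integral_const_mul]
  have h2 := hZ.integral_comp (f := fun k : ℕ => Complex.exp ((-(t * b) : ℝ) * Complex.I)
    * Complex.exp ((t * a : ℝ) * (k : ℝ) * Complex.I)) .of_discrete
  rw [← h2]
  refine integral_congr_ae (ae_of_all _ fun ω => ?_)
  simp only [Function.comp, ← Complex.exp_add]
  congr 1
  push_cast
  ring

/-- The generating function of the number of collisions converges to that of the Poisson law. -/
lemma tendsto_iidExp_pow_collisions {m : ℕ → ℕ} {p : ∀ n, Fin (m n) → ℝ} (hm : ∀ n, 0 < m n)
    (hp : ∀ n i, 0 < p n i) (hp1 : ∀ n, ∑ i, p n i = 1) {lam : ℝ}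
    (hrate : Tendsto (fun n : ℕ => (n : ℝ) / √(m n : ℝ)) atTop (𝓝 lam))
    (hV : Tendsto (fun n => invProbVar (p n) (m n)) atTop (𝓝 0)) {z : ℂ} (hz : ‖z‖ = 1) :
    Tendsto (fun n => iidExp (p n) n (fun x => z ^ collisions (lightClasses (p n) (m n)) x))
      atTop (𝓝 (Complex.exp ((z - 1) * (lam ^ 2 / 2 : ℝ)))) := by
  have hr2 : Tendsto (fun n : ℕ => (n : ℝ) ^ 2 / m n) atTop (𝓝 (lam ^ 2)) := by
    refine (hrate.pow 2).congr fun n => ?_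
    rw [div_pow, Real.sq_sqrt (Nat.cast_nonneg _)]
  have hinv : Tendsto (fun n : ℕ => (n : ℝ)⁻¹) atTop (𝓝 0) := tendsto_inv_atTop_nhds_zero_nat
  have hsq : Tendsto (fun n : ℕ => √((n : ℝ)⁻¹)) atTop (𝓝 0) := by
    simpa using hinv.sqrt
  have hsV : Tendsto (fun n => √(invProbVar (p n) (m n))) atTop (𝓝 0) := by
    simpa using hV.sqrt
  have hexp : Tendsto (fun n : ℕ => Complex.exp ((z - 1) * ((n : ℝ) * (n - 1) / (2 * m n) : ℝ)))
      atTop (𝓝 (Complex.exp ((z - 1) * (lam ^ 2 / 2 : ℝ)))) := by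
    have h : Tendsto (fun n : ℕ => (n : ℝ) * (n - 1) / (2 * m n)) atTop (𝓝 (lam ^ 2 / 2)) := by
      have h1 := (hr2.mul (hinv.const_sub 1)).div_const 2
      simp only [sub_zero, mul_one] at h1
      refine h1.congr' ?_
      filter_upwards [eventually_gt_atTop 0] with n hn
      have := hm n
      field_simp
    exact (Complex.continuous_exp.tendsto _).comp
      (((Complex.continuous_ofReal.tendsto _).comp h).const_mul _)
  -- `m` grows like `n² / λ²`, hence faster than `n`.
  have hlarge : ∀ᶠ n : ℕ in atTop, 2 * (n : ℝ) ≤ m n := by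
    have h1 := hr2.mul hinv
    rw [mul_zero] at h1
    filter_upwards [eventually_gt_atTop 0, h1.eventually_le_const (by norm_num : (0 : ℝ) < 1 / 2)]
      with n hn h2
    have hmn : (0 : ℝ) < m n := by exact_mod_cast hm n
    have : (n : ℝ) ^ 2 / m n * (n : ℝ)⁻¹ = n / m n := by field_simp
    rw [this, div_le_iff₀ hmn] at h2
    linarith
  -- The accumulated error rewritten in terms of the convergent ratio `n² / m`, using `√n = n
  -- √(1/n)`, so that each term carries a factor tending to 0.
  have hdiff : Tendsto (fun n : ℕ => 12 * ((n : ℝ) ^ 2 / m n) ^ 2 * (n : ℝ)⁻¹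
      + 4 * ((n : ℝ) ^ 2 / m n) * √((n : ℝ)⁻¹)
      + 2 * ((n : ℝ) ^ 2 / m n)
        * (2 * √(invProbVar (p n) (m n)) + 4 * invProbVar (p n) (m n))) atTop (𝓝 0) := by
    have := ((((hr2.pow 2).const_mul 12).mul hinv).add ((hr2.const_mul 4).mul hsq)).add
      ((hr2.const_mul 2).mul ((hsV.const_mul 2).add (hV.const_mul 4)))
    simpa using this
  have hz0 : Tendsto (fun n : ℕ =>
      iidExp (p n) n (fun x => z ^ collisions (lightClasses (p n) (m n)) x)
        - Complex.exp ((z - 1) * ((n : ℝ) * (n - 1) / (2 * m n) : ℝ))) atTop (𝓝 0) := by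
    refine squeeze_zero_norm' ?_ hdiff
    filter_upwards [eventually_gt_atTop 0, hlarge] with n hn hl
    have hmn : (0 : ℝ) < m n := by exact_mod_cast hm n
    refine (norm_iidExp_pow_collisions_sub_exp_le (fun i => (hp n i).le) (hp1 n) hmn
      (fun i hi => by simpa [lightClasses] using hi) hz hl).trans ?_
    have hd := abs_sum_light_sq_sub_le (hp n) (hp1 n) hmn
    have hs : √(n : ℝ) = n * √((n : ℝ)⁻¹) := by
      rw [Real.sqrt_inv, ← div_eq_mul_inv, Real.div_sqrt]
    calc _ ≤ (n : ℝ) * (12 * n ^ 2 / m n ^ 2 + 4 * √n / m n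
          + 2 * n * ((2 * √(invProbVar (p n) (m n)) + 4 * invProbVar (p n) (m n)) / m n)) := by
          gcongr
      _ = _ := by
          rw [hs]
          field_simp
  simpa using hz0.add hexp

/-- The characteristic function of the centred and scaled Pearson statistic converges. -/
lemma tendsto_iidExp_exp_centredPearson {m : ℕ → ℕ} {p : ∀ n, Fin (m n) → ℝ}
    (hm : ∀ n, 0 < m n) (hp : ∀ n i, 0 < p n i) (hp1 : ∀ n, ∑ i, p n i = 1)
    (hmean : ∀ n, ∑ i, p n i * ((m n * p n i)⁻¹ - 1) = 0) {lam : ℝ} (hlam : 0 < lam)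
    (hrate : Tendsto (fun n : ℕ => (n : ℝ) / √(m n : ℝ)) atTop (𝓝 lam))
    (hnV : Tendsto (fun n : ℕ => n * invProbVar (p n) (m n)) atTop (𝓝 0)) (t : ℝ) :
    Tendsto (fun n : ℕ => iidExp (p n) n (fun x => Complex.exp
        ((t * centredPearson (p n) (m n) (√(2 * m n) / n) x : ℝ) * Complex.I)))
      atTop (𝓝 (Complex.exp ((-(t * (lam / √2)) : ℝ) * Complex.I)
        * Complex.exp ((Complex.exp ((t * (√2 / lam) : ℝ) * Complex.I) - 1)
          * (lam ^ 2 / 2 : ℝ)))) := by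
  have hV : Tendsto (fun n => invProbVar (p n) (m n)) atTop (𝓝 0) := by
    refine squeeze_zero' (Eventually.of_forall fun n => invProbVar_nonneg fun i => (hp n i).le)
      ?_ hnV
    filter_upwards [eventually_ge_atTop 1] with n hn
    have h1 : (1 : ℝ) ≤ n := by exact_mod_cast hn
    exact le_mul_of_one_le_left (invProbVar_nonneg fun i => (hp n i).le) h1
  have hr2 : Tendsto (fun n : ℕ => (n : ℝ) ^ 2 / m n) atTop (𝓝 (lam ^ 2)) := by
    refine (hrate.pow 2).congr fun n => ?_
    rw [div_pow, Real.sq_sqrt (Nat.cast_nonneg _)]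
  have hc : Tendsto (fun n : ℕ => √(2 * m n) / n) atTop (𝓝 (√2 / lam)) := by
    refine ((tendsto_const_nhds (x := √2)).div hrate hlam.ne').congr fun n => ?_
    rw [Pi.div_apply, Real.sqrt_mul zero_le_two, div_div_eq_mul_div]
  -- `a` is the limit of the scale `c`, and `a⁻¹` is the centring `λ / √2` of the limit law.
  set a := √2 / lam with ha
  have ha0 : a ≠ 0 := by positivity
  have hb : lam / √2 = a⁻¹ := by rw [ha, inv_div]
  set z := Complex.exp ((t * a : ℝ) * Complex.I) with hz
  have hz1 : ‖z‖ = 1 := Complex.norm_exp_ofReal_mul_I _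
  have hG := (tendsto_iidExp_pow_collisions hm hp hp1 hrate hV hz1).const_mul
    (Complex.exp ((-(t * a⁻¹) : ℝ) * Complex.I))
  have hsV : Tendsto (fun n => √(invProbVar (p n) (m n))) atTop (𝓝 0) := by
    simpa using hV.sqrt
  have hsnV : Tendsto (fun n : ℕ => √(n * invProbVar (p n) (m n))) atTop (𝓝 0) := by
    simpa using hnV.sqrt
  have hB : Tendsto (fun n : ℕ => |t| * (√(2 * m n) / n * (n ^ 2 / m n)
        * √(invProbVar (p n) (m n)) + √(2 * m n) / n / 2 * √(n * invProbVar (p n) (m n))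
        + |√(2 * m n) / n - a| * (n ^ 2 / m n) + |(√(2 * m n) / n)⁻¹ - a⁻¹|)
        + 8 * (n * invProbVar (p n) (m n))) atTop (𝓝 0) := by
    have h1 := (hc.sub_const a).abs
    have h2 := ((hc.inv₀ ha0).sub_const a⁻¹).abs
    have := ((((((hc.mul hr2).mul hsV).add ((hc.div_const 2).mul hsnV)).add
      (h1.mul hr2)).add h2).const_mul |t|).add (hnV.const_mul 8)
    simpa using this
  have hD := squeeze_zero_norm (fun n : ℕ => norm_iidExp_exp_centredPearson_sub_le (n := n) (hp n)
    (hp1 n) (by exact_mod_cast hm n : (0 : ℝ) < m n) (hmean n)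
    (by positivity : 0 ≤ √(2 * (m n : ℝ)) / n) a t) hB
  rw [hb]
  have := hD.add hG
  rw [zero_add] at this
  refine this.congr fun n => ?_
  rw [← iidExp_const_mul]
  -- With `z = exp (i t a)`, the generating function of the collisions becomes the characteristic
  -- function of `a * C - a⁻¹` at `t`.
  have e : ∀ x : Fin n → Fin (m n), Complex.exp ((-(t * a⁻¹) : ℝ) * Complex.I)
      * z ^ collisions (lightClasses (p n) (m n)) x = Complex.exp
        ((t * (a * collisions (lightClasses (p n) (m n)) x - a⁻¹) : ℝ) * Complex.I) := by
    intro x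
    rw [hz, ← Complex.exp_nat_mul, ← Complex.exp_add]
    congr 1
    push_cast
    ring
  simp only [e, sub_add_cancel]

/-- The mean of `1 / p (X)` is the number of classes, so centring and dividing by it gives `1 / (M
p) - 1`. This translates condition (C) into a statement on `invProbVar`. -/
lemma variance_inv_prob_eq {Ω ι : Type*} [MeasurableSpace Ω] {P : Measure Ω}
    [IsProbabilityMeasure P] [Fintype ι] [MeasurableSpace ι] [MeasurableSingletonClass ι]
    {p : ι → ℝ} {X₀ : Ω → ι} (hX₀ : Measurable X₀)
    (hp : ∀ i, P.real {ω | X₀ ω = i} = p i) (hp_pos : ∀ i, 0 < p i)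
    (hι : 0 < Fintype.card ι) :
    Var[fun ω => (p (X₀ ω))⁻¹; P]
      = (Fintype.card ι : ℝ) ^ 2 * invProbVar p (Fintype.card ι) := by
  have hmeas : Measurable (fun i : ι => (p i)⁻¹) := .of_discrete
  have hmean : ∫ ω, (p (X₀ ω))⁻¹ ∂P = Fintype.card ι := by
    rw [integral_comp_eq_sum hX₀ hp (fun i => (p i)⁻¹)]
    simp [fun i => mul_inv_cancel₀ (hp_pos i).ne']
  rw [variance_eq_integral (X := fun ω => (p (X₀ ω))⁻¹) (hmeas.comp hX₀).aemeasurable, hmean,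
    integral_comp_eq_sum hX₀ hp (fun i => ((p i)⁻¹ - (Fintype.card ι : ℝ)) ^ 2), invProbVar,
    Finset.mul_sum]
  refine Finset.sum_congr rfl fun i _ => ?_
  have h1 := (hp_pos i).ne'
  have h2 : (Fintype.card ι : ℝ) ≠ 0 := by positivity
  rw [smul_eq_mul]
  field_simp

theorem theorem1
    (m : ℕ → ℕ) (p : ∀ n, Fin (m n) → ℝ)
    {Ω : ℕ → Type*} [∀ n, MeasurableSpace (Ω n)]
    (P : ∀ n, Measure (Ω n)) [∀ n, IsProbabilityMeasure (P n)]
    -- the generic variable `X_n` and the sample `X_{n,1}, …, X_{n,n}`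
    (X₀ : ∀ n, Ω n → Fin (m n)) (X : ∀ n, Fin n → Ω n → Fin (m n))
    (hX₀ : ∀ n, Measurable (X₀ n)) (hX : ∀ n k, Measurable (X n k))
    (hp : ∀ n i, (P n).real {ω | X₀ n ω = i} = p n i) (hp_pos : ∀ n i, 0 < p n i)
    (hindep : ∀ n, iIndepFun (X n) (P n))
    (hident : ∀ n k, IdentDistrib (X n k) (X₀ n) (P n) (P n))
    (hC : Tendsto (fun n : ℕ => Var[fun ω => (p n (X₀ n ω))⁻¹; P n] / ((m n : ℝ) * n))
      atTop (𝓝 0))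
    (lam : ℝ) (hlam : 0 < lam)
    (hrate : Tendsto (fun n : ℕ => (n : ℝ) / √(m n : ℝ)) atTop (𝓝 lam))
    {Ω' : Type*} [MeasurableSpace Ω'] (P' : Measure Ω') [IsProbabilityMeasure P']
    (Z : Ω' → ℕ) (hZ : HasLaw Z (poissonMeasure ⟨lam ^ 2 / 2, by positivity⟩) P') :
    TendstoInDistribution
      (fun n ω => (pearsonChiSq (p n) (fun k => X n k ω) - (m n : ℝ)) / √(2 * (m n : ℝ)))
      atTop
      (fun ω' => √2 / lam * (Z ω' : ℝ) - lam / √2)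
      P P' := by
  -- A probability space is nonempty, so `Fin (m n)` has an element.
  have hm : ∀ n, 0 < m n := fun n => by
    obtain ⟨ω⟩ := nonempty_of_isProbabilityMeasure (P n)
    exact (X₀ n ω).pos
  have hp1 : ∀ n, ∑ i, p n i = 1 := fun n => by
    simpa using (integral_comp_eq_sum (hX₀ n) (hp n) (fun _ => (1 : ℝ))).symm
  have hmean : ∀ n, ∑ i, p n i * ((m n * p n i)⁻¹ - 1) = 0 := fun n => by
    have hmn : (m n : ℝ) ≠ 0 := by exact_mod_cast (hm n).ne'
    have e : ∀ i, p n i * ((m n * p n i)⁻¹ - 1) = (m n : ℝ)⁻¹ - p n i := fun i => by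
      have := (hp_pos n i).ne'
      field_simp
    simp only [e, Finset.sum_sub_distrib, hp1]
    simp [hmn]
  have hnV : Tendsto (fun n : ℕ => n * invProbVar (p n) (m n)) atTop (𝓝 0) := by
    -- `n V = (Var / (m n)) * (n² / m)`, and the second factor converges to `λ²`.
    have h := hC.mul (hrate.pow 2)
    rw [zero_mul] at h
    refine h.congr' ?_
    filter_upwards [eventually_gt_atTop 0] with n hn
    have hmn := hm n
    have := variance_inv_prob_eq (hX₀ n) (hp n) (hp_pos n) (by simpa using hmn)
    rw [this, Fintype.card_fin, div_pow, Real.sq_sqrt (Nat.cast_nonneg _)]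
    field_simp
  have hmeas : ∀ n, Measurable (fun ω =>
      (pearsonChiSq (p n) (fun k => X n k ω) - (m n : ℝ)) / √(2 * (m n : ℝ))) := fun n =>
    (Measurable.of_discrete (f := fun x : Fin n → Fin (m n) =>
      (pearsonChiSq (p n) x - (m n : ℝ)) / √(2 * (m n : ℝ)))).comp (measurable_pi_lambda _ (hX n))
  have hZm := hZ.aemeasurable
  refine ⟨fun n => (hmeas n).aemeasurable, by fun_prop, ?_⟩
  refine ProbabilityMeasure.tendsto_iff_tendsto_charFun.2 ?_
  intro t
  simp only [ProbabilityMeasure.coe_mk]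
  rw [charFun_map_affine_poisson hZ]
  refine (tendsto_iidExp_exp_centredPearson hm hp_pos hp1 hmean hlam hrate hnV t).congr' ?_
  -- The row `n = 0` must be discarded: there the scale `√(2m) / n` is 0 by convention and the
  -- identity for the statistic fails.
  filter_upwards [eventually_gt_atTop 0] with n hn
  rw [charFun_apply_real, integral_map (hmeas n).aemeasurable (by fun_prop),
    ← integral_sample_eq_iidExp (hX₀ n) (hX n) (hp n) (hindep n) (hident n)]
  refine integral_congr_ae (ae_of_all _ fun ω => ?_)
  simp only [pearsonChiSq_eq_centredPearson hn (hp_pos n) (hp1 n) (hm n)]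
  push_cast
  rfl
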